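/- In the Mermin--GHZ game, Alice, Bob and Charlie receive bits $x^{(A)},x^{(B)},x^{(C)}$ with $x^{(A)}+x^{(B)}+x^{(C)}\equiv 0 \pmod 2$ and, without communicating, must output bits $y^{(A)},y^{(B)},y^{(C)}$ with $$y^{(A)}\oplus y^{(B)}\oplus y^{(C)}=\frac{x^{(A)}+x^{(B)}+x^{(C)}}{2}.$$ The Mermin--GHZ correlations are the probabilities $\Pr(y^{(A)},y^{(B)},y^{(C)}\mid x^{(A)},x^{(B)},x^{(C)})$, for these inputs, that arise when the participants share the state $\frac{1}{\sqrt2}(|000\rangle+|111\rangle)$ and each measures the Pauli observable $X$ on input $0$ and $Y$ on input $1$, outputting $y$ for the eigenvalue $(-1)^y$. A strategy simulates these correlations if it wins the game with probability one on every admissible input and its output probabilities on every admissible input equal the Mermin--GHZ correlations. A non-local box (NLB) is a device with two ends that, on input bits $a$ and $b$, returns bits $z$ and $w$ at the respective ends, uniformly distributed over the solutions of $z\oplus w=a\wedge b$. Then the following hold. 1. The quantum strategy on the state $\frac{1}{\sqrt2}(|000\rangle+|111\rangle)$ described above wins the Mermin--GHZ game with probability one. 2. There is a classical protocol without communication, using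 shared randomness and a single use of one NLB shared by Alice and Bob, that simulates the Mermin--GHZ correlations. 3. Suppose that two of the participants (any two) share a qubit pair in a state $\alpha|00\rangle+\beta|11\rangle$ with $\alpha,\beta\in\mathbb{C}$, $|\alpha|^2+|\beta|^2=1$, and that there is no further entanglement. Then no strategy without communication, in which the participants use shared randomness and local quantum measurements (POVMs), wins the Mermin--GHZ game with probability one; in particular none simulates the Mermin--GHZ correlations. 4. The same holds if each two of the three participants share such a qubit pair $\alpha_k|00\rangle+\beta_k|11\rangle$, $k=1,2,3$ (one pair for each two participants, with possibly different coefficients), and there is no further entanglement. -/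

import Mathlib

open MeasureTheory
open scoped ComplexOrder

noncomputable section

/-! The three participants are `0` (Alice), `1` (Bob) and `2` (Charlie), elements of `Fin 3`.
Inputs and outputs are bits.  A correlation `P` assigns to every input triple `x` and every
output triple `y` the probability `P x y` of the outputs `y` given the inputs `x`. -/

/-- Conditional probabilities of three output bits given three input bits. -/
abbrev TriCorrelation : Type := (Fin 3 → Bool) → (Fin 3 → Bool) → ℝ

namespace MerminGHZ

/-- The promise on the inputs: their sum is even. -/
def Promise (x : Fin 3 → Bool) : Prop :=
  (∑ i, (x i).toNat) % 2 = 0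

/-- The winning condition: the exclusive or of the outputs is half the sum of the inputs. -/
def WinRel (x y : Fin 3 → Bool) : Prop :=
  (((y 0).xor (y 1)).xor (y 2)).toNat = (∑ i, (x i).toNat) / 2

open Classical in
/-- On every admissible input the winning outputs have total probability one. -/
def Wins (P : TriCorrelation) : Prop :=
  ∀ x, Promise x → ∑ y : Fin 3 → Bool, (if WinRel x y then P x y else 0) = 1

end MerminGHZ

/-- A strategy without communication for three participants, each of whom holds a quantum register
with computational basis indexed by `reg`.  The participants have access to common (and hence also
to private) classical randomness `ω : Ω`.  Given the input `x` and `ω`, participant `i` performs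
the measurement (POVM) `meas i x ω` on their register and outputs the outcome. -/
structure QuantumStrategy (Ω : Type*) [MeasurableSpace Ω] (reg : Type*)
    [Fintype reg] [DecidableEq reg] where
  meas : Fin 3 → Bool → Ω → Bool → Matrix reg reg ℂ
  posSemidef : ∀ i x ω y, (meas i x ω y).PosSemidef
  sum_eq_one : ∀ i x ω, ∑ y, meas i x ω y = 1
  measurable : ∀ i x y s t, Measurable fun ω => meas i x ω y s t

/-- The Born rule: `⟨ψ, (E 0 ⊗ E 1 ⊗ E 2) ψ⟩` for a vector `ψ` given by its amplitudes in the
product basis of the three registers. -/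
def bornProb {reg : Type*} [Fintype reg] [DecidableEq reg]
    (ψ : (Fin 3 → reg) → ℂ) (E : Fin 3 → Matrix reg reg ℂ) : ℝ :=
  (∑ s : Fin 3 → reg, ∑ t : Fin 3 → reg,
    (starRingEnd ℂ) (ψ s) * (∏ i, E i (s i) (t i)) * ψ t).re

/-- The correlation of a quantum strategy, for the shared state `ψ` and the law `μ` of the
classical randomness. -/
def QuantumStrategy.correlation {Ω : Type*} [MeasurableSpace Ω] {reg : Type*}
    [Fintype reg] [DecidableEq reg] (S : QuantumStrategy Ω reg)
    (μ : Measure Ω) (ψ : (Fin 3 → reg) → ℂ) : TriCorrelation :=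
  fun x y => ∫ ω, bornProb ψ (fun i => S.meas i (x i) ω (y i)) ∂μ

/-- Amplitudes of the two-qubit state `α|00⟩ + β|11⟩`. -/
def qubitPair (α β : ℂ) (a b : Fin 2) : ℂ :=
  if a = b then (if a = 0 then α else β) else 0

/-- Participants `i` and `j` hold the two halves of `α|00⟩ + β|11⟩`; the remaining participant
has a qubit in the state `|0⟩`, uncorrelated with everything else. -/
def onePairState (i j : Fin 3) (α β : ℂ) (s : Fin 3 → Fin 2) : ℂ :=
  qubitPair α β (s i) (s j) * (if ∀ k, k ≠ i → k ≠ j → s k = 0 then 1 else 0)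

/-- Each two of the three participants share a qubit pair.  Participant `k` holds two qubits: the
first one is half of the pair `α k |00⟩ + β k |11⟩` shared with participant `k + 1` (mod 3), the
second one is half of the pair shared with participant `k - 1` (mod 3). -/
def allPairsState (α β : Fin 3 → ℂ) (s : Fin 3 → Fin 2 × Fin 2) : ℂ :=
  ∏ k : Fin 3, qubitPair (α k) (β k) (s k).1 (s (k + 1)).2

/-- The state `(|000⟩ + |111⟩) / √2`. -/
def ghzState (s : Fin 3 → Fin 2) : ℂ :=
  if s 0 = s 1 ∧ s 1 = s 2 then ((Real.sqrt 2 : ℝ) : ℂ)⁻¹ else 0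

namespace MerminGHZ

/-- The Pauli matrix `X` on input `0`, the Pauli matrix `Y` on input `1`. -/
def pauli (x : Bool) : Matrix (Fin 2) (Fin 2) ℂ :=
  if x then !![0, -Complex.I; Complex.I, 0] else !![0, 1; 1, 0]

/-- The projection onto the eigenspace of `pauli x` for the eigenvalue `(-1) ^ y`. -/
def pauliProj (x y : Bool) : Matrix (Fin 2) (Fin 2) ℂ :=
  (1 / 2 : ℂ) • (1 + (if y then (-1 : ℂ) else 1) • pauli x)

theorem pauliProj_eq (x y : Bool) :
    pauliProj x y = (pauliProj x y).conjTranspose * pauliProj x y := by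
  have h : (starRingEnd ℂ) 2 = 2 := Complex.conj_ofNat 2
  ext i j
  fin_cases i <;> fin_cases j <;> cases x <;> cases y <;>
    simp [pauliProj, pauli, Matrix.mul_apply, Fin.sum_univ_two, h] <;>
    ring_nf <;> norm_num

theorem pauliProj_posSemidef (x y : Bool) : (pauliProj x y).PosSemidef := by
  rw [pauliProj_eq]
  exact Matrix.posSemidef_conjTranspose_mul_self _

theorem pauliProj_sum (x : Bool) : ∑ y, pauliProj x y = 1 := by
  ext i j
  fin_cases i <;> fin_cases j <;> cases x <;>
    simp [pauliProj, pauli] <;> norm_num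

/-- The quantum winning strategy: each participant measures their qubit of the GHZ state
with `X` on input `0` and with `Y` on input `1`.  No classical randomness is used. -/
def ghzStrategy : QuantumStrategy Unit (Fin 2) where
  meas _ x _ y := pauliProj x y
  posSemidef _ x _ y := pauliProj_posSemidef x y
  sum_eq_one _ x _ := pauliProj_sum x
  measurable _ _ _ _ _ := measurable_const

/-- The Mermin--GHZ correlations: those of the quantum winning strategy on the GHZ state. -/
def correlation : TriCorrelation :=
  ghzStrategy.correlation (Measure.dirac ()) ghzState

/-- `P` simulates the Mermin--GHZ correlations: it wins the game with probability one, and on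
every admissible input its probabilities are those of the quantum winning strategy. -/
def Simulates (P : TriCorrelation) : Prop :=
  Wins P ∧ ∀ x, Promise x → ∀ y, P x y = correlation x y

end MerminGHZ

/-- The non-local box: on inputs `a`, `b` the probability of the outputs `z`, `w`.  The solutions
of `z ⊕ w = a ∧ b` are equally likely (there are two of them), nothing else occurs. -/
def nonLocalBox (a b z w : Bool) : ℝ :=
  if z.xor w = (a && b) then 1 / 2 else 0

/-- A classical protocol for three participants without communication, with shared randomness
`ω : Ω`, in which Alice and Bob use a single non-local box once.  Each of them computes
the input to their end of the box from their input and `ω`, and the output also from the bit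
received from the box. -/
structure OneBoxProtocol (Ω : Type*) [MeasurableSpace Ω] where
  boxInA : Bool → Ω → Bool
  boxInB : Bool → Ω → Bool
  outA : Bool → Ω → Bool → Bool
  outB : Bool → Ω → Bool → Bool
  outC : Bool → Ω → Bool
  measurable_boxInA : ∀ x, Measurable (boxInA x)
  measurable_boxInB : ∀ x, Measurable (boxInB x)
  measurable_outA : ∀ x z, Measurable fun ω => outA x ω z
  measurable_outB : ∀ x w, Measurable fun ω => outB x ω w
  measurable_outC : ∀ x, Measurable (outC x)

/-- The correlation of a protocol with one non-local box, for the law `μ` of the randomness. -/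
def OneBoxProtocol.correlation {Ω : Type*} [MeasurableSpace Ω] (S : OneBoxProtocol Ω)
    (μ : Measure Ω) : TriCorrelation :=
  fun x y => ∫ ω, ∑ z : Bool, ∑ w : Bool,
    nonLocalBox (S.boxInA (x 0) ω) (S.boxInB (x 1) ω) z w *
      (if S.outA (x 0) ω z = y 0 ∧ S.outB (x 1) ω w = y 1 ∧ S.outC (x 2) ω = y 2
        then 1 else 0) ∂μ

end

/-! A strategy that wins with probability one has, for almost every value of the randomness, local
measurements whose losing outcomes annihilate the shared state `ψ`. The differences `A₀, A₁`,
`B₀, B₁`, `C₀, C₁` of the two effects then satisfy on `ψ` the relations of the Pauli observables on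
the GHZ state, `A₀ψ = B₀C₀ψ` and `A₀ψ = -B₁C₁ψ` with their permutations, and hence
`A₀A₁ψ = B₀B₁ψ = C₀C₁ψ`. This vector is nonzero, orthogonal to `ψ`, and each participant can produce
it from `ψ` alone. On the other hand, if the state comes from independent sources none of which
reaches all three participants, then a vector that each of them can produce alone is proportional to
`ψ`: in exchanging the systems of one source, an operator of a participant whom it does not reach
changes the amplitudes by the same factor as those of `ψ`. -/

open scoped Matrix Matrix.Module

section Tensor

variable {ι reg R : Type*} [Fintype ι]

/-- The matrix of the tensor product `⨂ i, E i` in the product basis. -/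
def piKronecker [CommMonoid R] (E : ι → Matrix reg reg R) : Matrix (ι → reg) (ι → reg) R :=
  .of fun s t => ∏ i, E i (s i) (t i)

theorem piKronecker_apply [CommMonoid R] (E : ι → Matrix reg reg R) (s t : ι → reg) :
    piKronecker E s t = ∏ i, E i (s i) (t i) :=
  rfl

theorem piKronecker_star [CommMonoid R] [StarMul R] (E : ι → Matrix reg reg R) :
    piKronecker (star E) = star (piKronecker E) := by
  ext s t
  simp [piKronecker_apply, Matrix.star_apply]

variable [CommSemiring R]

theorem piKronecker_one [DecidableEq reg] : piKronecker (1 : ι → Matrix reg reg R) = 1 := by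
  ext s t
  simp only [piKronecker_apply, Pi.one_apply, Matrix.one_apply, Finset.prod_ite_zero,
    Finset.prod_const_one, Finset.mem_univ, true_implies, funext_iff]

variable [DecidableEq ι]

theorem piKronecker_mul [Fintype reg] (E F : ι → Matrix reg reg R) :
    piKronecker E * piKronecker F = piKronecker (E * F) := by
  ext s u
  simp only [piKronecker_apply, Matrix.mul_apply, Pi.mul_apply, ← Finset.prod_mul_distrib]
  rw [Finset.prod_univ_sum, Fintype.piFinset_univ]

theorem sum_piKronecker {α : Type*} [Fintype α] (E : ι → α → Matrix reg reg R) :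
    ∑ y : ι → α, piKronecker (fun i => E i (y i)) = piKronecker fun i => ∑ a, E i a := by
  ext s t
  simp only [Matrix.sum_apply, piKronecker_apply, Finset.prod_univ_sum, Fintype.piFinset_univ]

theorem piKronecker_mulSingle_apply [DecidableEq reg] (i : ι) (M : Matrix reg reg R)
    (s t : ι → reg) :
    piKronecker (Pi.mulSingle i M) s t =
      M (s i) (t i) * if ∀ j ≠ i, s j = t j then 1 else 0 := by
  have hrest : ∀ j ∈ Finset.univ.erase i,
      (Pi.mulSingle i M : ι → Matrix reg reg R) j (s j) (t j) = if s j = t j then 1 else 0 :=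
    fun j hj => by rw [Pi.mulSingle_eq_of_ne (Finset.ne_of_mem_erase hj), Matrix.one_apply]
  rw [piKronecker_apply, ← Finset.mul_prod_erase _ _ (Finset.mem_univ i), Pi.mulSingle_eq_same,
    Finset.prod_congr rfl hrest, Finset.prod_ite_zero]
  simp

omit [DecidableEq ι] in
theorem piKronecker_posSemidef {𝕜 : Type*} [RCLike 𝕜] [Finite reg] {E : ι → Matrix reg reg 𝕜}
    (hE : ∀ i, (E i).PosSemidef) : (piKronecker E).PosSemidef := by
  classical
  cases nonempty_fintype reg
  have hsqrt : ∀ i, ∃ B : Matrix reg reg 𝕜, E i = star B * B := fun i => by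
    open scoped MatrixOrder in
    exact CStarAlgebra.nonneg_iff_eq_star_mul_self.mp (hE i).nonneg
  choose B hB using hsqrt
  have hEB : E = star B * B := funext hB
  rw [hEB, ← piKronecker_mul, piKronecker_star, Matrix.star_eq_conjTranspose]
  exact Matrix.posSemidef_conjTranspose_mul_self _

variable [Fintype reg] [DecidableEq reg]

/-- The operator `M` on the register of participant `i`, as an operator on all registers. -/
def localOp (i : ι) : Matrix reg reg R →ₐ[R] Matrix (ι → reg) (ι → reg) R where
  toFun M := piKronecker (Pi.mulSingle i M)
  map_one' := by rw [Pi.mulSingle_one, piKronecker_one]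
  map_mul' M N := by rw [piKronecker_mul, Pi.mulSingle_mul]
  map_zero' := by
    ext s t
    simp only [piKronecker_mulSingle_apply, Matrix.zero_apply, zero_mul]
  map_add' M N := by
    ext s t
    simp only [piKronecker_mulSingle_apply, Matrix.add_apply, add_mul]
  commutes' r := by
    have hdiag (s t : ι → reg) : ((∀ j ≠ i, s j = t j) ∧ s i = t i) ↔ s = t :=
      ⟨fun h => funext fun j => (eq_or_ne j i).elim (fun hj => hj ▸ h.2) (h.1 j),
        fun h => by simp [h]⟩
    ext s t
    simp only [piKronecker_mulSingle_apply, Matrix.algebraMap_matrix_apply, mul_ite, mul_one,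
      mul_zero, ← ite_and, hdiag]

theorem localOp_eq_piKronecker (i : ι) (M : Matrix reg reg R) :
    localOp i M = piKronecker (Pi.mulSingle i M) :=
  rfl

theorem star_localOp [StarRing R] (i : ι) (M : Matrix reg reg R) :
    star (localOp i M) = localOp i (star M) := by
  rw [localOp_eq_piKronecker, localOp_eq_piKronecker, ← piKronecker_star]
  exact congrArg piKronecker (funext fun j => (Pi.apply_mulSingle
    (M := fun _ => Matrix reg reg R) (fun _ => star) (fun _ => star_one _) i M j))

theorem localOp_commute {i j : ι} (hij : i ≠ j) (M N : Matrix reg reg R) :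
    Commute (localOp i M) (localOp j N) := by
  simp only [Commute, SemiconjBy, localOp_eq_piKronecker, piKronecker_mul]
  exact congrArg _ (Pi.mulSingle_commute (f := fun _ : ι => Matrix reg reg R) hij M N)

theorem localOp_smul_apply {R : Type*} [CommRing R] (i : ι) (M : Matrix reg reg R)
    (v : (ι → reg) → R) (s : ι → reg) :
    (localOp i M • v) s = ∑ a, M (s i) a * v (Function.update s i a) := by
  refine (Fintype.sum_of_injective (Function.update s i) (Function.update_injective s i) _ _
    (fun t ht => ?_) fun a => ?_).symm
  · have hne : ¬ ∀ j ≠ i, s j = t j := fun h => ht ⟨t i, by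
      rw [Function.update_eq_iff]
      exact ⟨rfl, h⟩⟩
    simp [localOp_eq_piKronecker, piKronecker_mulSingle_apply, hne]
  · have heq : ∀ j ≠ i, s j = Function.update s i a j := fun j hj =>
      (Function.update_of_ne hj a s).symm
    simp only [localOp_eq_piKronecker, piKronecker_mulSingle_apply, if_pos heq,
      Function.update_self, mul_one, smul_eq_mul]

theorem localOp_mul_localOp_mul_localOp {i j k : Fin 3} (hij : i ≠ j) (hik : i ≠ k) (hjk : j ≠ k)
    (E : Fin 3 → Matrix reg reg R) :
    localOp i (E i) * localOp j (E j) * localOp k (E k) = piKronecker E := by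
  simp only [localOp_eq_piKronecker, piKronecker_mul]
  congr 1
  funext l
  have hl : l = i ∨ l = j ∨ l = k := by lia
  rcases hl with rfl | rfl | rfl <;> simp [*, hij.symm, hik.symm, hjk.symm]

end Tensor

section LocallyRigid

variable {ι reg R : Type*} [Fintype ι] [DecidableEq ι] [Fintype reg] [DecidableEq reg] [CommRing R]

/-- A vector is locally rigid if every vector that each single participant can produce from it, by
an operator on their own register, is proportional to it. Proportionality is expressed by the
vanishing of the `2 × 2` minors. -/
def IsLocallyRigid (ψ : (ι → reg) → R) : Prop :=
  ∀ (Z : ι → Matrix reg reg R) (u : (ι → reg) → R), (∀ i, localOp i (Z i) • ψ = u) →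
    ∀ s t, u s * ψ t = u t * ψ s

theorem localOp_smul_apply_mul_eq {ψ : (ι → reg) → R} {s s' : ι → reg} {c c' : R} {i : ι}
    (hi : s i = s' i) (h : ∀ a, ψ (Function.update s i a) * c = ψ (Function.update s' i a) * c')
    (M : Matrix reg reg R) :
    (localOp i M • ψ) s * c = (localOp i M • ψ) s' * c' := by
  simp only [localOp_smul_apply, Finset.sum_mul, mul_assoc, h, hi]

theorem isLocallyRigid_of_eq_mul {ψ : (ι → reg) → R} {j k : ι} (hjk : j ≠ k) (f : reg → R)
    (g : (ι → reg) → R) (hg : ∀ s a, g (Function.update s k a) = g s)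
    (hψ : ∀ s, ψ s = f (s k) * g s) : IsLocallyRigid ψ := by
  intro Z u hZ s t
  have hswap_left : u s * f (t k) = u (Function.update s k (t k)) * f (s k) := by
    rw [← hZ j]
    refine localOp_smul_apply_mul_eq (by rw [Function.update_of_ne hjk]) (fun a => ?_) _
    rw [hψ, hψ, Function.update_comm hjk.symm, hg, Function.update_self,
      Function.update_of_ne hjk.symm]
    ring
  have hswap_right : u (Function.update s k (t k)) * g t = u t * g s := by
    rw [← hZ k]
    refine localOp_smul_apply_mul_eq (by rw [Function.update_self]) (fun a => ?_) _
    simp only [hψ, Function.update_self, hg]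
    ring
  rw [hψ s, hψ t]
  linear_combination g t * hswap_left + f (s k) * hswap_right

theorem IsLocallyRigid.eq_zero_of_dotProduct_eq_zero [StarRing R] {ψ : (ι → reg) → R}
    (hψ : IsLocallyRigid ψ) (hunit : star ψ ⬝ᵥ ψ = 1) {Z : ι → Matrix reg reg R}
    {u : (ι → reg) → R} (hZ : ∀ i, localOp i (Z i) • ψ = u) (hu : star ψ ⬝ᵥ u = 0) : u = 0 := by
  funext s
  calc u s = star ψ ⬝ᵥ (u s • ψ) := by rw [dotProduct_smul, hunit, smul_eq_mul, mul_one]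
    _ = star ψ ⬝ᵥ (ψ s • u) := congrArg _ (funext fun t => by
        rw [Pi.smul_apply, Pi.smul_apply, smul_eq_mul, smul_eq_mul, hψ Z u hZ s t, mul_comm])
    _ = 0 := by rw [dotProduct_smul, hu, smul_zero]

end LocallyRigid

section Triangle

variable {κ κ' R : Type*} [CommRing R]

/-- The state of a triangle of bipartite sources: source `k` emits `φ k`, whose first half goes to
participant `k` and whose second half goes to participant `k + 1` (mod 3). -/
def triangleState (φ : Fin 3 → κ → κ' → R) (s : Fin 3 → κ × κ') : R :=
  ∏ k, φ k (s k).1 (s (k + 1)).2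

/-- The basis state `s` with the two systems emitted by source `k` replaced by those of `t`. -/
def replaceSource (k : Fin 3) (s t : Fin 3 → κ × κ') : Fin 3 → κ × κ' :=
  fun j => (if j = k then (t j).1 else (s j).1, if j = k + 1 then (t j).2 else (s j).2)

theorem triangleState_apply (φ : Fin 3 → κ → κ' → R) (s : Fin 3 → κ × κ') :
    triangleState φ s = φ 0 (s 0).1 (s 1).2 * φ 1 (s 1).1 (s 2).2 * φ 2 (s 2).1 (s 0).2 :=
  Fin.prod_univ_three _

variable [Fintype κ] [DecidableEq κ] [Fintype κ'] [DecidableEq κ']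

/-- Source `k` does not reach participant `k + 2`. -/
theorem localOp_smul_triangleState_replaceSource (φ : Fin 3 → κ → κ' → R) (k : Fin 3)
    (M : Matrix (κ × κ') (κ × κ') R) (s t : Fin 3 → κ × κ') :
    (localOp (k + 2) M • triangleState φ) s * φ k (t k).1 (t (k + 1)).2 =
      (localOp (k + 2) M • triangleState φ) (replaceSource k s t) *
        φ k (s k).1 (s (k + 1)).2 := by
  refine localOp_smul_apply_mul_eq ?_ (fun a => ?_) M
  · fin_cases k <;> rfl
  · simp only [triangleState_apply, Function.update_apply, replaceSource]
    fin_cases k <;>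
      simp only [Fin.zero_eta, Fin.mk_one, Fin.reduceFinMk, Fin.reduceAdd, Fin.reduceEq,
        zero_add, zero_ne_one, one_ne_zero, ↓reduceIte] <;>
      ring

theorem isLocallyRigid_triangleState (φ : Fin 3 → κ → κ' → R) :
    IsLocallyRigid (triangleState φ) := by
  intro Z u hZ s t
  have hswap (k : Fin 3) (s : Fin 3 → κ × κ') :
      u s * φ k (t k).1 (t (k + 1)).2 =
        u (replaceSource k s t) * φ k (s k).1 (s (k + 1)).2 := by
    rw [← hZ (k + 2)]
    exact localOp_smul_triangleState_replaceSource φ k (Z (k + 2)) s t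
  set s₁ := replaceSource 0 s t
  set s₂ := replaceSource 1 s₁ t
  have hswap₀ : u s * φ 0 (t 0).1 (t 1).2 = u s₁ * φ 0 (s 0).1 (s 1).2 := hswap 0 s
  have hswap₁ : u s₁ * φ 1 (t 1).1 (t 2).2 = u s₂ * φ 1 (s 1).1 (s 2).2 := hswap 1 s₁
  have hswap₂ : u s₂ * φ 2 (t 2).1 (t 0).2 = u t * φ 2 (s 2).1 (s 0).2 := by
    have hreplace : replaceSource 2 s₂ t = t := by
      funext j
      fin_cases j <;> rfl
    exact hreplace ▸ hswap 2 s₂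
  rw [triangleState_apply, triangleState_apply]
  linear_combination φ 1 (t 1).1 (t 2).2 * φ 2 (t 2).1 (t 0).2 * hswap₀ +
    φ 0 (s 0).1 (s 1).2 * φ 2 (t 2).1 (t 0).2 * hswap₁ +
    φ 0 (s 0).1 (s 1).2 * φ 1 (s 1).1 (s 2).2 * hswap₂

end Triangle

section BinaryMeasurement

variable {A M : Type*} [Ring A] [AddCommGroup M] [Module A M]

/-- The observable of a binary measurement, with the value `(-1) ^ y` on the outcome `y`. -/
def observable (P : Bool → A) : A :=
  P false - P true

/-- The measurement of the exclusive or of the outcomes of two binary measurements. -/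
def parity (P Q : Bool → A) (e : Bool) : A :=
  ∑ a, P a * Q (a.xor e)

theorem observable_parity (P Q : Bool → A) :
    observable (parity P Q) = observable P * observable Q := by
  simp only [observable, parity, Fintype.sum_bool, Bool.true_xor, Bool.false_xor, Bool.not_false,
    Bool.not_true]
  noncomm_ring

theorem sum_parity (P Q : Bool → A) : ∑ e, parity P Q e = (∑ a, P a) * ∑ b, Q b := by
  simp only [parity, Fintype.sum_bool, Bool.true_xor, Bool.false_xor, Bool.not_false,
    Bool.not_true]
  noncomm_ring

variable {P Q : Bool → A} {v : M} {w : Bool}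

theorem smul_eq_smul_xor (hP : ∑ a, P a = 1) (hQ : ∑ b, Q b = 1)
    (h : ∀ a b, a.xor b ≠ w → P a • Q b • v = 0) (a : Bool) : P a • v = Q (a.xor w) • v := by
  have hleft : P a • v = P a • Q (a.xor w) • v := by
    conv_lhs => rw [← one_smul A v, ← hQ, Finset.sum_smul, Finset.smul_sum]
    exact Fintype.sum_eq_single _ fun b hb => h a b fun hw => hb (by simp [← hw])
  have hright : Q (a.xor w) • v = P a • Q (a.xor w) • v := by
    conv_lhs => rw [← one_smul A (Q _ • v), ← hP, Finset.sum_smul]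
    exact Fintype.sum_eq_single _ fun b hb => h b _ (by
      revert hb; cases a <;> cases b <;> cases w <;> decide)
  rw [hleft, ← hright]

theorem observable_smul_eq (hP : ∑ a, P a = 1) (hQ : ∑ b, Q b = 1)
    (h : ∀ a b, a.xor b ≠ w → P a • Q b • v = 0) :
    observable P • v = if w then -(observable Q • v) else observable Q • v := by
  simp only [observable, sub_smul, smul_eq_smul_xor hP hQ h]
  cases w <;> simp

theorem observable_smul_observable_smul (hP : ∑ a, P a = 1) (hQ : ∑ b, Q b = 1)
    (h : ∀ a b, a.xor b ≠ w → P a • Q b • v = 0) : observable P • observable P • v = v := by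
  have horthogonal (a : Bool) : P a • P (!a) • v = 0 := by
    rw [smul_eq_smul_xor hP hQ h]
    exact h a _ (by cases a <;> cases w <;> decide)
  have h₀ : P false • P true • v = 0 := horthogonal false
  have h₁ : P true • P false • v = 0 := horthogonal true
  calc observable P • observable P • v
      = (∑ a, P a) • (∑ a, P a) • v - (2 : ℕ) • (P false • P true • v + P true • P false • v) := by
        simp only [observable, Fintype.sum_bool, sub_smul, add_smul, smul_sub, smul_add]
        abel
    _ = v := by rw [h₀, h₁, hP, one_smul, one_smul, add_zero, smul_zero, sub_zero]

end BinaryMeasurement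

section GHZRelations

variable {A M : Type*} [Ring A] [AddCommGroup M] [Module A M]

/-- The relations satisfied on the shared state `v` by the observables `O i x` of a perfect strategy
for the Mermin--GHZ game. -/
structure GHZRelations (O : Fin 3 → Bool → A) (v : M) : Prop where
  commute : ∀ {i j}, i ≠ j → ∀ x y, Commute (O i x) (O j y)
  smul_smul_self : ∀ i x, O i x • O i x • v = v
  smul_xor : ∀ {i j k}, i ≠ j → i ≠ k → j ≠ k → ∀ x y,
    O i (x.xor y) • v = if x || y then -(O j x • O k y • v) else O j x • O k y • v

namespace GHZRelations

variable {O : Fin 3 → Bool → A} {v : M}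

theorem smul_left_comm (h : GHZRelations O v) {i j : Fin 3} (hij : i ≠ j) (x y : Bool) (u : M) :
    O i x • O j y • u = O j y • O i x • u := by
  rw [smul_smul, smul_smul, (h.commute hij x y).eq]

theorem smul_false_smul_true_eq (h : GHZRelations O v) {i k : Fin 3} (hik : i ≠ k) :
    O i false • O i true • v = O k false • O k true • v := by
  obtain ⟨j, hji, hjk⟩ : ∃ j, j ≠ i ∧ j ≠ k := by decide +revert
  calc O i false • O i true • v = O i false • -(O j true • O k false • v) :=
        congrArg _ (h.smul_xor hji.symm hik hjk true false)
    _ = O k false • -(O i false • O j true • v) := by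
        rw [h.smul_left_comm hjk, smul_neg, h.smul_left_comm hik, smul_neg]
    _ = O k false • O k true • v :=
        congrArg _ (h.smul_xor hik.symm hjk.symm hji.symm false true).symm

theorem smul_false_smul_true_eq_neg (h : GHZRelations O v) (k : Fin 3) :
    O k false • O k true • v = -(O k true • O k false • v) := by
  obtain ⟨i, j, hij, hik, hjk⟩ : ∃ i j, i ≠ j ∧ i ≠ k ∧ j ≠ k := by decide +revert
  calc O k false • O k true • v = O i false • O i true • v := h.smul_false_smul_true_eq hik.symm
    _ = O i false • -(O j false • O k true • v) :=
        congrArg _ (h.smul_xor hij hik hjk false true)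
    _ = -(O k true • O i false • O j false • v) := by
        rw [h.smul_left_comm hjk, smul_neg, h.smul_left_comm hik]
    _ = -(O k true • O k false • v) :=
        congrArg (fun u => -(O k true • u)) (h.smul_xor hik.symm hjk.symm hij false false).symm

theorem smul_false_smul_true_ne_zero (h : GHZRelations O v) (hv : v ≠ 0) (k : Fin 3) :
    O k false • O k true • v ≠ 0 := by
  obtain ⟨i, j, hki, hkj, hij⟩ : ∃ i j, k ≠ i ∧ k ≠ j ∧ i ≠ j := by decide +revert
  intro hzero
  have hsq : O k false • O k false • O k true • v = O k true • v := by
    have htrue : O k true • v = -(O i true • O j false • v) := h.smul_xor hki hkj hij true false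
    simp only [htrue, smul_neg, h.smul_left_comm hki, h.smul_left_comm hkj, h.smul_smul_self]
  apply hv
  rw [← h.smul_smul_self k true, ← hsq, hzero, smul_zero, smul_zero]

end GHZRelations

end GHZRelations

section Game

theorem sum_fin_three_of_ne {M : Type*} [AddCommMonoid M] {i j k : Fin 3} (hij : i ≠ j)
    (hik : i ≠ k) (hjk : j ≠ k) (f : Fin 3 → M) : ∑ l, f l = f i + f j + f k := by
  have huniv : (Finset.univ : Finset (Fin 3)) = {i, j, k} := by decide +revert
  rw [huniv, Finset.sum_insert (by simp [hij, hik]), Finset.sum_pair hjk, add_assoc]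

theorem exists_fin_three_eq {α : Type*} {i j k : Fin 3} (hij : i ≠ j) (hik : i ≠ k) (hjk : j ≠ k)
    (a b c : α) : ∃ f : Fin 3 → α, f i = a ∧ f j = b ∧ f k = c :=
  ⟨Function.update (Function.update (fun _ => c) j b) i a, by simp [hij.symm, hik.symm, hjk.symm]⟩

namespace MerminGHZ

variable {x y : Fin 3 → Bool} {P : TriCorrelation}

theorem promise_iff_of_ne {i j k : Fin 3} (hij : i ≠ j) (hik : i ≠ k) (hjk : j ≠ k) :
    Promise x ↔ x i = (x j).xor (x k) := by
  rw [Promise, sum_fin_three_of_ne hij hik hjk]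
  generalize x i = a, x j = b, x k = c
  decide +revert

theorem xor_fin_three_of_ne {i j k : Fin 3} (hij : i ≠ j) (hik : i ≠ k) (hjk : j ≠ k) :
    ((y 0).xor (y 1)).xor (y 2) = ((y i).xor (y j)).xor (y k) := by
  decide +revert

theorem Promise.winRel_iff_of_ne (hx : Promise x) {i j k : Fin 3} (hij : i ≠ j) (hik : i ≠ k)
    (hjk : j ≠ k) : WinRel x y ↔ ((y i).xor (y j)).xor (y k) = (x j || x k) := by
  rw [WinRel, xor_fin_three_of_ne hij hik hjk, sum_fin_three_of_ne hij hik hjk,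
    (promise_iff_of_ne hij hik hjk).mp hx]
  generalize x j = a, x k = b, ((y i).xor (y j)).xor (y k) = c
  decide +revert

theorem wins_iff (hnonneg : ∀ x y, 0 ≤ P x y) (hsum : ∀ x, ∑ y, P x y = 1) :
    Wins P ↔ ∀ x, Promise x → ∀ y, ¬ WinRel x y → P x y = 0 := by
  classical
  refine forall₂_congr fun x _ => ?_
  rw [← hsum x, Finset.sum_eq_sum_iff_of_le fun y _ => by split_ifs <;> simp [hnonneg]]
  refine ⟨fun h y hy => ?_, fun h y _ => ?_⟩
  · rw [← h y (Finset.mem_univ y), if_neg hy]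
  · split_ifs with hy
    exacts [rfl, (h y hy).symm]

end MerminGHZ

end Game

section Strategy

variable {reg : Type*} [Fintype reg] [DecidableEq reg]

theorem bornProb_eq (ψ : (Fin 3 → reg) → ℂ) (E : Fin 3 → Matrix reg reg ℂ) :
    bornProb ψ E = (star ψ ⬝ᵥ (piKronecker E • ψ)).re := by
  simp only [bornProb, dotProduct, Matrix.Module.smul_apply, smul_eq_mul, Finset.mul_sum,
    piKronecker_apply, Pi.star_apply, mul_assoc, starRingEnd_apply]

theorem bornProb_nonneg (ψ : (Fin 3 → reg) → ℂ) {E : Fin 3 → Matrix reg reg ℂ}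
    (hE : ∀ i, (E i).PosSemidef) : 0 ≤ bornProb ψ E := by
  rw [bornProb_eq]
  exact (Complex.le_def.mp ((piKronecker_posSemidef hE).dotProduct_mulVec_nonneg ψ)).1

theorem piKronecker_smul_eq_zero {ψ : (Fin 3 → reg) → ℂ} {E : Fin 3 → Matrix reg reg ℂ}
    (hE : ∀ i, (E i).PosSemidef) (h : bornProb ψ E = 0) : piKronecker E • ψ = 0 := by
  have hpos := piKronecker_posSemidef hE
  refine (hpos.dotProduct_mulVec_zero_iff ψ).mp (Complex.ext ?_ ?_)
  · rwa [bornProb_eq] at h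
  · exact (Complex.le_def.mp (hpos.dotProduct_mulVec_nonneg ψ)).2.symm

namespace QuantumStrategy

variable {Ω : Type*} [MeasurableSpace Ω] (S : QuantumStrategy Ω reg) (μ : Measure Ω)
  (ψ : (Fin 3 → reg) → ℂ)

theorem bornProb_meas_nonneg (x y : Fin 3 → Bool) (ω : Ω) :
    0 ≤ bornProb ψ fun i => S.meas i (x i) ω (y i) :=
  bornProb_nonneg ψ fun i => S.posSemidef i (x i) ω (y i)

theorem sum_bornProb_meas (x : Fin 3 → Bool) (ω : Ω) :
    ∑ y : Fin 3 → Bool, bornProb ψ (fun i => S.meas i (x i) ω (y i)) = (star ψ ⬝ᵥ ψ).re := by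
  simp only [bornProb_eq, ← Complex.re_sum]
  rw [← dotProduct_sum, ← Finset.sum_smul, sum_piKronecker fun i => S.meas i (x i) ω]
  simp only [S.sum_eq_one]
  rw [← Pi.one_def, piKronecker_one, one_smul]

theorem measurable_bornProb_meas (x y : Fin 3 → Bool) :
    Measurable fun ω => bornProb ψ fun i => S.meas i (x i) ω (y i) :=
  Complex.measurable_re.comp <| Finset.measurable_fun_sum _ fun s _ =>
    Finset.measurable_fun_sum _ fun t _ => ((Finset.measurable_fun_prod _ fun i _ =>
      S.measurable i (x i) (y i) (s i) (t i)).const_mul _).mul_const _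

theorem integrable_bornProb_meas [IsFiniteMeasure μ] (x y : Fin 3 → Bool) :
    Integrable (fun ω => bornProb ψ fun i => S.meas i (x i) ω (y i)) μ := by
  refine .of_bound (S.measurable_bornProb_meas ψ x y).aestronglyMeasurable (star ψ ⬝ᵥ ψ).re
    (.of_forall fun ω => ?_)
  rw [Real.norm_of_nonneg (S.bornProb_meas_nonneg ψ x y ω), ← S.sum_bornProb_meas ψ x ω]
  exact Finset.single_le_sum (fun y _ => S.bornProb_meas_nonneg ψ x y ω) (Finset.mem_univ y)

theorem correlation_nonneg (x y : Fin 3 → Bool) : 0 ≤ S.correlation μ ψ x y :=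
  integral_nonneg (S.bornProb_meas_nonneg ψ x y)

variable [IsProbabilityMeasure μ] {ψ}

theorem sum_correlation (hψ : star ψ ⬝ᵥ ψ = 1) (x : Fin 3 → Bool) :
    ∑ y, S.correlation μ ψ x y = 1 := by
  simp only [correlation]
  rw [← integral_finsetSum _ fun y _ => S.integrable_bornProb_meas μ ψ x y]
  simp [sum_bornProb_meas, hψ]

open MerminGHZ

theorem wins_iff (hψ : star ψ ⬝ᵥ ψ = 1) : Wins (S.correlation μ ψ) ↔
    ∀ x, Promise x → ∀ y, ¬ WinRel x y → S.correlation μ ψ x y = 0 :=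
  MerminGHZ.wins_iff (S.correlation_nonneg μ ψ) (S.sum_correlation μ hψ)

theorem exists_piKronecker_meas_smul_eq_zero (hψ : star ψ ⬝ᵥ ψ = 1)
    (hwins : Wins (S.correlation μ ψ)) : ∃ ω, ∀ x, Promise x → ∀ y, ¬ WinRel x y →
      piKronecker (fun i => S.meas i (x i) ω (y i)) • ψ = 0 := by
  have hzero : ∀ᵐ ω ∂μ, ∀ x, Promise x → ∀ y, ¬ WinRel x y →
      bornProb ψ (fun i => S.meas i (x i) ω (y i)) = 0 := by
    simp only [ae_all_iff, Filter.eventually_imp_distrib_left]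
    exact fun x hx y hy => (integral_eq_zero_iff_of_nonneg (S.bornProb_meas_nonneg ψ x y)
      (S.integrable_bornProb_meas μ ψ x y)).mp ((S.wins_iff μ hψ).mp hwins x hx y hy)
  obtain ⟨ω, hω⟩ := hzero.exists
  exact ⟨ω, fun x hx y hy =>
    piKronecker_smul_eq_zero (fun i => S.posSemidef i (x i) ω (y i)) (hω x hx y hy)⟩

end QuantumStrategy

end Strategy

section PerfectStrategy

variable {reg R : Type*} [Fintype reg] [DecidableEq reg] [CommRing R]

theorem localOp_smul_eq_zero_of_xor_ne {E : Fin 3 → Bool → Bool → Matrix reg reg R}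
    {ψ : (Fin 3 → reg) → R} (hlose : ∀ x, MerminGHZ.Promise x → ∀ y, ¬ MerminGHZ.WinRel x y →
      piKronecker (fun i => E i (x i) (y i)) • ψ = 0)
    {i j k : Fin 3} (hij : i ≠ j) (hik : i ≠ k) (hjk : j ≠ k) {x y a b c : Bool}
    (hne : (a.xor b).xor c ≠ (x || y)) :
    localOp i (E i (x.xor y) a) • localOp j (E j x b) • localOp k (E k y c) • ψ = 0 := by
  obtain ⟨inp, hi, rfl, rfl⟩ := exists_fin_three_eq hij hik hjk (x.xor y) x y
  obtain ⟨out, rfl, rfl, rfl⟩ := exists_fin_three_eq hij hik hjk a b c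
  have hx : MerminGHZ.Promise inp := (MerminGHZ.promise_iff_of_ne hij hik hjk).mpr hi
  rw [← hi, smul_smul, smul_smul, localOp_mul_localOp_mul_localOp hij hik hjk
    fun l => E l (inp l) (out l)]
  exact hlose inp hx out fun hwin => hne ((hx.winRel_iff_of_ne hij hik hjk).mp hwin)

theorem ghzRelations_localOp_observable {E : Fin 3 → Bool → Bool → Matrix reg reg R}
    (hE : ∀ i x, ∑ y, E i x y = 1) {ψ : (Fin 3 → reg) → R}
    (hlose : ∀ x, MerminGHZ.Promise x → ∀ y, ¬ MerminGHZ.WinRel x y →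
      piKronecker (fun i => E i (x i) (y i)) • ψ = 0) :
    GHZRelations (fun i x => localOp i (observable (E i x))) ψ := by
  let P (i : Fin 3) (x a : Bool) : Matrix (Fin 3 → reg) (Fin 3 → reg) R := localOp i (E i x a)
  have hobs (i x) : localOp i (observable (E i x)) = observable (P i x) := map_sub _ _ _
  have hP (i x) : ∑ a, P i x a = 1 := by rw [← map_sum, hE, map_one]
  have hPP (j k x y) : ∑ e, parity (P j x) (P k y) e = 1 := by rw [sum_parity, hP, hP, one_mul]
  have hzero {i j k : Fin 3} (hij : i ≠ j) (hik : i ≠ k) (hjk : j ≠ k) (x y a e : Bool)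
      (hne : a.xor e ≠ (x || y)) : P i (x.xor y) a • parity (P j x) (P k y) e • ψ = 0 := by
    simp only [parity, Finset.sum_smul, Finset.smul_sum, mul_smul]
    exact Finset.sum_eq_zero fun b _ =>
      localOp_smul_eq_zero_of_xor_ne hlose hij hik hjk (by simpa using hne)
  refine ⟨fun hij x y => localOp_commute hij _ _, fun i x => ?_, fun {i j k} hij hik hjk x y => ?_⟩
  · obtain ⟨j, k, hij, hik, hjk⟩ : ∃ j k, i ≠ j ∧ i ≠ k ∧ j ≠ k := by decide +revert
    rw [hobs]
    refine observable_smul_observable_smul (hP i x) (hPP j k x false) (w := x) fun a e hne => ?_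
    simpa using hzero hij hik hjk x false a e (by simpa using hne)
  · simp only [hobs]
    rw [observable_smul_eq (hP i _) (hPP j k x y) (hzero hij hik hjk x y), observable_parity,
      mul_smul]

variable [StarRing R]

theorem star_dotProduct_smul_eq {n : Type*} [Fintype n] [DecidableEq n] {H : Matrix n n R}
    (hH : H.IsHermitian) (v w : n → R) : star (H • v) ⬝ᵥ w = star v ⬝ᵥ (H • w) := by
  change star (H *ᵥ v) ⬝ᵥ w = star v ⬝ᵥ (H *ᵥ w)
  rw [Matrix.star_mulVec, hH.eq, Matrix.dotProduct_mulVec]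

theorem GHZRelations.dotProduct_smul_false_smul_true [IsAddTorsionFree R] {n : Type*} [Fintype n]
    [DecidableEq n] {O : Fin 3 → Bool → Matrix n n R} {v : n → R} (h : GHZRelations O v)
    (hO : ∀ i x, (O i x).IsHermitian) (k : Fin 3) :
    star v ⬝ᵥ (O k false • O k true • v) = 0 := by
  obtain ⟨i, j, hki, hkj, hij⟩ : ∃ i j, k ≠ i ∧ k ≠ j ∧ i ≠ j := by decide +revert
  have hfalse : O k false • v = O i false • O j false • v := h.smul_xor hki hkj hij false false
  refine self_eq_neg.mp ?_
  calc star v ⬝ᵥ (O k false • O k true • v)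
      = star (O i false • O j false • v) ⬝ᵥ (O k true • v) := by
        rw [← star_dotProduct_smul_eq (hO k false), hfalse]
    _ = star v ⬝ᵥ (O k true • O i false • O j false • v) := by
        rw [star_dotProduct_smul_eq (hO i false), star_dotProduct_smul_eq (hO j false),
          ← h.smul_left_comm hki, ← h.smul_left_comm hkj, h.smul_left_comm hij]
    _ = -(star v ⬝ᵥ (O k false • O k true • v)) := by
        rw [← hfalse, ← dotProduct_neg, h.smul_false_smul_true_eq_neg, neg_neg]

theorem IsLocallyRigid.not_wins {ψ : (Fin 3 → reg) → ℂ} (hψ : IsLocallyRigid ψ)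
    (hunit : star ψ ⬝ᵥ ψ = 1) {Ω : Type*} [MeasurableSpace Ω] (μ : Measure Ω)
    [IsProbabilityMeasure μ] (S : QuantumStrategy Ω reg) :
    ¬ MerminGHZ.Wins (S.correlation μ ψ) := by
  intro hwins
  obtain ⟨ω, hω⟩ := S.exists_piKronecker_meas_smul_eq_zero μ hunit hwins
  let D (i : Fin 3) (x : Bool) : Matrix reg reg ℂ := observable (S.meas i x ω)
  have hGHZ : GHZRelations (fun i x => localOp i (D i x)) ψ :=
    ghzRelations_localOp_observable (fun i x => S.sum_eq_one i x ω) hω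
  have hherm (i x) : (localOp (ι := Fin 3) i (D i x)).IsHermitian := by
    have hD : star (D i x) = D i x :=
      ((S.posSemidef i x ω false).isHermitian.sub (S.posSemidef i x ω true).isHermitian).eq
    rw [Matrix.IsHermitian, ← Matrix.star_eq_conjTranspose, star_localOp, hD]
  have hne : ψ ≠ 0 := by
    rintro rfl
    simp at hunit
  refine hGHZ.smul_false_smul_true_ne_zero hne 0 (hψ.eq_zero_of_dotProduct_eq_zero hunit
    (Z := fun i => D i false * D i true) (fun i => ?_)
    (hGHZ.dotProduct_smul_false_smul_true hherm 0))
  rw [map_mul, mul_smul]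
  obtain rfl | hi := eq_or_ne i 0
  exacts [rfl, hGHZ.smul_false_smul_true_eq hi]

end PerfectStrategy

section GHZState

open Complex

theorem sum_ghzState_mul (F : (Fin 3 → Fin 2) → ℂ) :
    ∑ s, ghzState s * F s = (Real.sqrt 2 : ℂ)⁻¹ * ∑ a, F fun _ => a := by
  rw [Finset.mul_sum]
  refine (Fintype.sum_of_injective (fun a _ => a) (fun _ _ h => congrFun h 0) _ _ (fun s hs => ?_)
    fun a => by simp [ghzState]).symm
  have hs' : ¬ (s 0 = s 1 ∧ s 1 = s 2) := fun h => hs ⟨s 0, funext fun i => by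
    fin_cases i <;> simp [h]⟩
  rw [ghzState, if_neg hs', zero_mul]

theorem star_ghzState : star ghzState = ghzState := by
  funext s
  rw [Pi.star_apply, ghzState]
  split_ifs <;> simp

theorem sqrt_two_inv_mul_sqrt_two_inv_mul (z : ℂ) :
    (Real.sqrt 2 : ℂ)⁻¹ * ((Real.sqrt 2 : ℂ)⁻¹ * z) = z / 2 := by
  rw [← mul_assoc, ← mul_inv, ← ofReal_mul, Real.mul_self_sqrt zero_le_two]
  push_cast
  ring

theorem star_ghzState_dotProduct : star ghzState ⬝ᵥ ghzState = 1 := by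
  rw [star_ghzState, dotProduct, sum_ghzState_mul]
  simp only [ghzState, and_self, if_true, Fin.sum_univ_two, ← mul_two]
  rw [sqrt_two_inv_mul_sqrt_two_inv_mul, div_self two_ne_zero]

theorem bornProb_ghzState (E : Fin 3 → Matrix (Fin 2) (Fin 2) ℂ) :
    bornProb ghzState E = (∑ a, ∑ b, ∏ i, E i a b).re / 2 := by
  have hmulVec (s) : (piKronecker E • ghzState) s =
      (Real.sqrt 2 : ℂ)⁻¹ * ∑ b, ∏ i, E i (s i) b := by
    simp only [Matrix.Module.smul_apply, smul_eq_mul, mul_comm _ (ghzState _), sum_ghzState_mul,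
      piKronecker_apply]
  rw [bornProb_eq, star_ghzState, dotProduct, sum_ghzState_mul]
  simp only [hmulVec, ← Finset.mul_sum]
  rw [sqrt_two_inv_mul_sqrt_two_inv_mul, div_ofNat_re]

namespace MerminGHZ

variable {x y : Fin 3 → Bool}

theorem pauliProj_apply_self (x y : Bool) (a : Fin 2) : pauliProj x y a a = 1 / 2 := by
  fin_cases a <;> cases x <;> cases y <;> simp [pauliProj, pauli]

theorem pauliProj_zero_one (x y : Bool) :
    pauliProj x y 0 1 = 1 / 2 * ((-1) ^ y.toNat * star (I ^ x.toNat)) := by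
  cases x <;> cases y <;> simp [pauliProj, pauli]

theorem pauliProj_one_zero (x y : Bool) :
    pauliProj x y 1 0 = 1 / 2 * ((-1) ^ y.toNat * I ^ x.toNat) := by
  cases x <;> cases y <;> simp [pauliProj, pauli]

theorem correlation_eq (x y : Fin 3 → Bool) :
    correlation x y = (1 + (-1) ^ (∑ i, (y i).toNat) * (I ^ ∑ i, (x i).toNat).re) / 8 := by
  simp only [correlation, QuantumStrategy.correlation, integral_dirac, ghzStrategy,
    bornProb_ghzState, Fin.sum_univ_two, pauliProj_apply_self, pauliProj_zero_one,
    pauliProj_one_zero, Finset.prod_mul_distrib, Finset.prod_pow_eq_pow_sum, ← star_prod,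
    Finset.prod_const, Finset.card_univ, Fintype.card_fin]
  generalize ∑ i, (y i).toNat = m
  generalize I ^ ∑ i, (x i).toNat = z
  have hadd : z + star z = ((2 * z.re : ℝ) : ℂ) := add_conj z
  calc _ = (((1 + (-1) ^ m * z.re) / 4 : ℝ) : ℂ).re / 2 := by
        congr 2
        push_cast at hadd ⊢
        linear_combination (-1) ^ m / 8 * hadd
    _ = _ := by
        rw [ofReal_re]
        ring

theorem correlation_eq_ite (hx : Promise x) : correlation x y =
    if ((y 0).xor (y 1)).xor (y 2) = (x 0 || x 1) then 1 / 4 else 0 := by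
  have hx₂ : x 2 = (x 0).xor (x 1) := (promise_iff_of_ne (by decide) (by decide) (by decide)).mp hx
  rw [correlation_eq, Fin.sum_univ_three, Fin.sum_univ_three, hx₂]
  cases x 0 <;> cases x 1 <;> cases y 0 <;> cases y 1 <;> cases y 2 <;> norm_num

theorem wins_correlation : Wins correlation := by
  refine (ghzStrategy.wins_iff _ star_ghzState_dotProduct).mpr fun x hx y hy => ?_
  have hlose : ¬ ((y 0).xor (y 1)).xor (y 2) = (x 0 || x 1) := by
    rwa [xor_fin_three_of_ne (i := 2) (j := 0) (k := 1), ← hx.winRel_iff_of_ne] <;> decide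
  exact (correlation_eq_ite hx).trans (if_neg hlose)

theorem simulates_iff {P : TriCorrelation} :
    Simulates P ↔ ∀ x, Promise x → ∀ y, P x y = correlation x y := by
  refine ⟨And.right, fun h => ⟨fun x hx => ?_, h⟩⟩
  simp only [h x hx]
  exact wins_correlation x hx

end MerminGHZ

end GHZState

section Box

namespace MerminGHZ

/-- The protocol with one non-local box that simulates the Mermin--GHZ correlations: Alice and Bob
feed their inputs to the box and Alice outputs what she receives; Bob masks the bit that he
receives, and Charlie masks his input, with a shared coin. -/
def boxProtocol : OneBoxProtocol Bool where
  boxInA x _ := x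
  boxInB x _ := x
  outA _ _ z := z
  outB _ r w := w.xor r
  outC x r := x.xor r
  measurable_boxInA _ := .of_discrete
  measurable_boxInB _ := .of_discrete
  measurable_outA _ _ := .of_discrete
  measurable_outB _ _ := .of_discrete
  measurable_outC _ := .of_discrete

theorem boxProtocol_correlation_eq (x y : Fin 3 → Bool) :
    boxProtocol.correlation (PMF.uniformOfFintype Bool).toMeasure x y =
      nonLocalBox (x 0) (x 1) (y 0) ((y 1).xor ((x 2).xor (y 2))) / 2 := by
  simp only [OneBoxProtocol.correlation, PMF.integral_eq_sum, boxProtocol, Fintype.sum_bool]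
  cases y 0 <;> cases y 1 <;> cases y 2 <;> cases x 2 <;> simp [div_eq_inv_mul]

theorem simulates_boxProtocol :
    Simulates (boxProtocol.correlation (PMF.uniformOfFintype Bool).toMeasure) := by
  refine simulates_iff.mpr fun x hx y => ?_
  have hx₂ : x 2 = (x 0).xor (x 1) := (promise_iff_of_ne (by decide) (by decide) (by decide)).mp hx
  rw [boxProtocol_correlation_eq, correlation_eq_ite hx, hx₂, nonLocalBox]
  cases x 0 <;> cases x 1 <;> cases y 0 <;> cases y 1 <;> cases y 2 <;> norm_num

end MerminGHZ

end Box

section QubitPairs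

theorem sum_star_qubitPair_mul_qubitPair {α β : ℂ} (h : ‖α‖ ^ 2 + ‖β‖ ^ 2 = 1) :
    ∑ a, ∑ b, star (qubitPair α β a b) * qubitPair α β a b = 1 := by
  have hstar (z : ℂ) : star z * z = (‖z‖ ^ 2 : ℝ) := by
    rw [Complex.ofReal_pow]
    exact Complex.conj_mul' z
  simp only [hstar, Fin.sum_univ_two]
  norm_cast
  simpa [qubitPair] using h

theorem onePairState_eq_mul {i j k : Fin 3} (hij : i ≠ j) (hki : k ≠ i) (hkj : k ≠ j) (α β : ℂ)
    (s : Fin 3 → Fin 2) :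
    onePairState i j α β s = (if s k = 0 then 1 else 0) * qubitPair α β (s i) (s j) := by
  have hk : (∀ l, l ≠ i → l ≠ j → s l = 0) ↔ s k = 0 :=
    ⟨fun h => h k hki hkj, fun h l hli hlj => by rwa [show l = k by omega]⟩
  simp only [onePairState, hk, mul_comm]

theorem isLocallyRigid_onePairState {i j : Fin 3} (hij : i ≠ j) (α β : ℂ) :
    IsLocallyRigid (onePairState i j α β) := by
  obtain ⟨k, hki, hkj⟩ := Fin.exists_ne_and_ne_of_two_lt i j (by decide)
  refine isLocallyRigid_of_eq_mul hki.symm (fun a => if a = 0 then 1 else 0)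
    (fun s => qubitPair α β (s i) (s j)) (fun s a => ?_) (onePairState_eq_mul hij hki hkj α β)
  simp only [Function.update_of_ne hki.symm, Function.update_of_ne hkj.symm]

theorem star_onePairState_dotProduct {i j : Fin 3} (hij : i ≠ j) {α β : ℂ}
    (h : ‖α‖ ^ 2 + ‖β‖ ^ 2 = 1) : star (onePairState i j α β) ⬝ᵥ onePairState i j α β = 1 := by
  obtain ⟨k, hki, hkj⟩ := Fin.exists_ne_and_ne_of_two_lt i j (by decide)
  have hinj : Function.Injective fun p : Fin 2 × Fin 2 =>
      Function.update (Function.update (0 : Fin 3 → Fin 2) i p.1) j p.2 := fun p q hpq =>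
    Prod.ext (by simpa [hij] using congrFun hpq i) (by simpa using congrFun hpq j)
  rw [← sum_star_qubitPair_mul_qubitPair h, ← Fintype.sum_prod_type']
  refine (Fintype.sum_of_injective _ hinj _ _ (fun s hs => ?_) fun p => ?_).symm
  · have hsk : s k ≠ 0 := fun hsk => hs ⟨(s i, s j), funext fun l => by
      obtain rfl | rfl | rfl : l = i ∨ l = j ∨ l = k := by omega
      all_goals simp [*]⟩
    rw [onePairState_eq_mul hij hki hkj, if_neg hsk, zero_mul, mul_zero]
  · simp [onePairState_eq_mul hij hki hkj, hij, hki, hkj]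

theorem star_triangleState_dotProduct {κ κ' R : Type*} [Fintype κ] [Fintype κ'] [CommRing R]
    [StarRing R] (φ : Fin 3 → κ → κ' → R) :
    star (triangleState φ) ⬝ᵥ triangleState φ = ∏ k, ∑ a, ∑ b, star (φ k a b) * φ k a b := by
  let bySource : (Fin 3 → κ × κ') ≃ (Fin 3 → κ × κ') :=
    { toFun s k := ((s k).1, (s (k + 1)).2)
      invFun t k := ((t k).1, (t (k - 1)).2)
      left_inv s := by simp
      right_inv t := by simp }
  simp only [← Fintype.sum_prod_type', Fintype.prod_sum]
  rw [← bySource.sum_comp, dotProduct]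
  simp only [Pi.star_apply, triangleState, star_prod, ← Finset.prod_mul_distrib]
  rfl

theorem star_allPairsState_dotProduct {α β : Fin 3 → ℂ}
    (h : ∀ k, ‖α k‖ ^ 2 + ‖β k‖ ^ 2 = 1) :
    star (allPairsState α β) ⬝ᵥ allPairsState α β = 1 :=
  (star_triangleState_dotProduct fun k => qubitPair (α k) (β k)).trans <|
    Finset.prod_eq_one fun k _ => sum_star_qubitPair_mul_qubitPair (h k)

end QubitPairs

/-- The Mermin--GHZ correlations come from a quantum winning strategy and are simulated with a
single use of one non-local box, but with qubit pairs `α|00⟩ + β|11⟩` in place of the box no quantum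
strategy, even with shared randomness, wins the game or simulates the correlations: neither if some
two participants share such a pair, nor if each two of them do. -/
theorem mainTheorem12 :
    MerminGHZ.Wins MerminGHZ.correlation ∧
    (∃ (Ω : Type) (_ : MeasurableSpace Ω) (μ : Measure Ω) (_ : IsProbabilityMeasure μ)
      (S : OneBoxProtocol Ω), MerminGHZ.Simulates (S.correlation μ)) ∧
    (∀ (i j : Fin 3), i ≠ j → ∀ (α β : ℂ), ‖α‖ ^ 2 + ‖β‖ ^ 2 = 1 →
      ∀ (Ω : Type*) [MeasurableSpace Ω] (μ : Measure Ω) [IsProbabilityMeasure μ]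
        (S : QuantumStrategy Ω (Fin 2)),
        ¬ MerminGHZ.Wins (S.correlation μ (onePairState i j α β)) ∧
        ¬ MerminGHZ.Simulates (S.correlation μ (onePairState i j α β))) ∧
    (∀ (α β : Fin 3 → ℂ), (∀ k, ‖α k‖ ^ 2 + ‖β k‖ ^ 2 = 1) →
      ∀ (Ω : Type*) [MeasurableSpace Ω] (μ : Measure Ω) [IsProbabilityMeasure μ]
        (S : QuantumStrategy Ω (Fin 2 × Fin 2)),
        ¬ MerminGHZ.Wins (S.correlation μ (allPairsState α β)) ∧
        ¬ MerminGHZ.Simulates (S.correlation μ (allPairsState α β))) := by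
  refine ⟨MerminGHZ.wins_correlation, ⟨Bool, inferInstance, (PMF.uniformOfFintype Bool).toMeasure,
    inferInstance, MerminGHZ.boxProtocol, MerminGHZ.simulates_boxProtocol⟩,
    fun i j hij α β h Ω _ μ _ S => ?_, fun α β h Ω _ μ _ S => ?_⟩
  · have hw := (isLocallyRigid_onePairState hij α β).not_wins
      (star_onePairState_dotProduct hij h) μ S
    exact ⟨hw, fun hsim => hw hsim.1⟩
  · have hw : ¬ MerminGHZ.Wins (S.correlation μ (allPairsState α β)) :=
      (isLocallyRigid_triangleState fun k => qubitPair (α k) (β k)).not_wins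
        (star_allPairsState_dotProduct h) μ S
    exact ⟨hw, fun hsim => hw hsim.1⟩
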